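/- Let $G=(V,E)$ be a finite undirected graph of processes, $V_t\subseteq V$ the set of trusted nodes, and $f\ge 0$. Processes communicate over the edges of $G$ by authenticated, reliable, asynchronous channels without digital signatures; at most $f$ nodes, all in $V\setminus V_t$, are Byzantine. **Protocol (DolevU-T).** To broadcast $m$, a process sends $[m,\emptyset]$ to all its neighbors and delivers $m$. When $p_i$ receives $[m,\mathit{path}]$ from its neighbor $p_j$, it forms $\mathit{fwd}=\mathit{path}+[p_j]$, whose first entry is the claimed broadcaster $p_s$ of $m$. Let $\mathit{path}'$ be $\mathit{fwd}$ with all trusted nodes removed. Then $p_i$ stores $\mathit{path}'\setminus\{p_s\}$ for $(p_s,m)$ and sends $[m,\mathit{fwd}]$ to all its neighbors that are not in $\mathit{path}'$. It delivers $m$ (as a message of $p_s$), unless it has already done so, once the paths stored for $(p_s,m)$ contain the empty path or $f+1$ pairwise vertex-disjoint paths. A process broadcasts a given message at most once. **Reliable communication.** Two nodes $u,v$ *can communicate reliably* in $G$ if in every execution of DolevU-T on $G$ in which at most $f$ nodes, all untrusted, are Byzantine and $u,v$ are correct, the following hold for the messages from $u$ to $v$ and for those from $v$ to $u$: (validity)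 if the sender broadcasts $m$, the receiver eventually delivers it; (no creation) if the receiver delivers $m$ as a message of the sender, then the sender broadcast $m$; (no duplication) the receiver delivers each message of the sender at most once. **Graphs.** Call distinct nodes $x,y$ *linked* if they are adjacent in $G$, or there are $n\ge 0$ and $t_0,\dots,t_n\in V_t$ such that $(x,t_0)$, $(t_n,y)$ and $(t_i,t_{i+1})$ for all $i<n$ are edges of $G$. The graph $f(G)$ has vertex set $V\setminus V_t$, and its edges join the linked pairs. For a graph $G'$ on a subset $V'$ of $V$ and $w\in V_t$, the graph $g(G,G',w)$ is obtained from $G'$ by adding the vertex $w$ and joining it to all nodes of $V'$ linked to it. $\Gamma_H(x)$ is the set of neighbors of $x$ in $H$, and $\kappa_H(x,y)$ is the vertex-connectivity between $x$ and $y$ in $H$, that is, the maximum number of internally vertex-disjoint paths of $H$ from $x$ to $y$. **Theorem.** Let $u_t\neq v_t$ be trusted nodes and $H=g(G,g(G,f(G),u_t),v_t)$. Then $u_t$ and $v_t$ can communicate reliably in $G$ using DolevU-T if and only if $u_t\in\Gamma_H(v_t)$ or $\kappa_H(u_t,v_t)\ge 2f+1$. The same equivalence holds with reliable communication replaced by validity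 alone (in both directions between $u_t$ and $v_t$). -/

import Mathlib

namespace DolevUT

section Graphs

variable {V : Type*}

/-- `u` and `v` are neighbours in `G`, or `G` contains a path `u, t 0, …, t n, v` all of whose
intermediate nodes `t 0, …, t n` (at least one) are trusted. -/
def Linked (G : SimpleGraph V) (Vt : Finset V) (u v : V) : Prop :=
  G.Adj u v ∨ ∃ (n : ℕ) (t : ℕ → V), (∀ i ≤ n, t i ∈ Vt) ∧ G.Adj u (t 0) ∧ G.Adj (t n) v ∧
    ∀ i < n, G.Adj (t i) (t (i + 1))

theorem Linked.symm {G : SimpleGraph V} {Vt : Finset V} {u v : V} (h : Linked G Vt u v) :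
    Linked G Vt v u := by
  rcases h with h | ⟨n, t, ht, h0, hn, hs⟩
  · exact Or.inl h.symm
  · refine Or.inr ⟨n, fun i => t (n - i), fun i _ => ht _ (Nat.sub_le _ _), ?_, ?_, ?_⟩
    · simpa using hn.symm
    · simpa using h0.symm
    · intro i hi
      have h1 := (hs (n - (i + 1)) (by omega)).symm
      have h2 : n - (i + 1) + 1 = n - i := by omega
      rwa [h2] at h1

/-- The graph `f(G)`. A graph on a subset of the node set `V` (whose edges need not be edges of
`G`) is represented by a subgraph of the complete graph on `V`. -/
def untrustedGraph (G : SimpleGraph V) (Vt : Finset V) : (⊤ : SimpleGraph V).Subgraph where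
  verts := {x | x ∉ Vt}
  Adj x y := x ∉ Vt ∧ y ∉ Vt ∧ x ≠ y ∧ Linked G Vt x y
  adj_sub h := by simpa using h.2.2.1
  edge_vert h := h.1
  symm := ⟨fun _ _ h => ⟨h.2.1, h.1, h.2.2.1.symm, h.2.2.2.symm⟩⟩

/-- The graph `g(G, H, w)`: the node `w` is added to `H` and joined to the nodes of `H` to which
it is linked in `G`. -/
def insertTrusted (G : SimpleGraph V) (Vt : Finset V) (H : (⊤ : SimpleGraph V).Subgraph) (w : V) :
    (⊤ : SimpleGraph V).Subgraph where
  verts := H.verts ∪ {w}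
  Adj x y := H.Adj x y ∨ (x ∈ H.verts ∧ y = w ∧ x ≠ w ∧ Linked G Vt x w) ∨
    (y ∈ H.verts ∧ x = w ∧ y ≠ w ∧ Linked G Vt y w)
  adj_sub h := by
    rcases h with h | ⟨_, rfl, h, _⟩ | ⟨_, rfl, h, _⟩
    · exact H.adj_sub h
    · simpa using h
    · simpa using h.symm
  edge_vert h := by
    rcases h with h | ⟨h, _⟩ | ⟨_, h, _⟩
    · exact Or.inl (H.edge_vert h)
    · exact Or.inl h
    · exact Or.inr h
  symm := ⟨fun _ _ h => by
    rcases h with h | h | h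
    · exact Or.inl h.symm
    · exact Or.inr (Or.inr h)
    · exact Or.inr (Or.inl h)⟩

/-- There are `k` distinct paths of `H` from `u` to `v`, no two of which share a node other than
`u` and `v`. -/
def HasDisjointPaths (H : (⊤ : SimpleGraph V).Subgraph) (u v : V) (k : ℕ) : Prop :=
  ∃ P : Fin k → H.spanningCoe.Path u v, Function.Injective P ∧
    ∀ i j, i ≠ j → ∀ x, x ∈ (P i).1.support → x ∈ (P j).1.support → x = u ∨ x = v

/-- The vertex-connectivity `κ_H(u, v)`: the maximum number of internally vertex-disjoint paths
of `H` from `u` to `v`. -/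
noncomputable def vertexConnectivity (H : (⊤ : SimpleGraph V).Subgraph) (u v : V) : ℕ∞ :=
  ⨆ (k : ℕ) (_ : HasDisjointPaths H u v k), (k : ℕ∞)

end Graphs

section Protocol

/-- A message `[payload, path]` in transit on the channel from `src` to `dst`. -/
structure Packet (V M : Type*) where
  src : V
  dst : V
  payload : M
  path : List V

/-- The variables of a process. The variables `paths` and `delivered` of the protocol are kept
separately for each broadcaster `s` and each payload `m`: `(s, m, l) ∈ paths` says that the path `l`
is in the variable `paths` of the pair `(s, m)`, and `(s, m) ∈ delivered` that its variable
`delivered` is true. -/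
structure LocalState (V M : Type*) where
  paths : Set (V × M × List V)
  delivered : Set (V × M)

/-- The variables of all processes, and the multiset of messages in transit. -/
structure NetState (V M : Type*) where
  loc : V → LocalState V M
  net : Multiset (Packet V M)

inductive Event (V M : Type*) where
  /-- `p` is asked to broadcast `m`. -/
  | broadcast (p : V) (m : M)
  /-- A message in transit is received by its addressee. -/
  | receive (pkt : Packet V M)
  /-- `p` delivers the message `m` of the broadcaster `s`, on the evidence of stored paths. -/
  | deliver (p s : V) (m : M)
  /-- A Byzantine node sends an arbitrary message on one of its channels. -/
  | byzantineSend (pkt : Packet V M)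
  | idle

variable {V M : Type*} [Fintype V] [DecidableEq V]

def initState : NetState V M := ⟨fun _ => ⟨∅, ∅⟩, 0⟩

/-- The path that the addressee of `pkt` forwards: the received path, extended by the sender. -/
def Packet.fwdPath (pkt : Packet V M) : List V := pkt.path ++ [pkt.src]

/-- The node from which the message claims to originate: the first entry of the extended path. -/
def Packet.broadcaster (pkt : Packet V M) : V := pkt.path.headD pkt.src

def removeAllTrusted (Vt : Finset V) (l : List V) : List V := l.filter (· ∉ Vt)

/-- The path that the addressee of `pkt` stores: the untrusted nodes of the extended path, without
the broadcaster. -/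
def Packet.storedPath (Vt : Finset V) (pkt : Packet V M) : List V :=
  (removeAllTrusted Vt pkt.fwdPath).filter (· ≠ pkt.broadcaster)

/-- `p` sends `[m, path]` to all nodes of `dests`. -/
def sendTo (p : V) (dests : Finset V) (m : M) (path : List V) : Multiset (Packet V M) :=
  dests.val.map fun q => ⟨p, q, m, path⟩

/-- The path condition for delivering the message `m` of `s`: an empty path or `f + 1`
vertex-disjoint paths have been stored. -/
def CanDeliver (f : ℕ) (σ : LocalState V M) (s : V) (m : M) : Prop :=
  (s, m, []) ∈ σ.paths ∨
    ∃ P : Fin (f + 1) → List V, Function.Injective P ∧ (∀ i, (s, m, P i) ∈ σ.paths) ∧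
      ∀ i j, i ≠ j → (P i).Disjoint (P j)

variable (G : SimpleGraph V) [DecidableRel G.Adj] (Vt : Finset V) (f : ℕ) (B : Finset V)

/-- The handler of a broadcast of `m` at `p`. -/
def onBroadcast (p : V) (m : M) (σ : NetState V M) : NetState V M where
  loc := Function.update σ.loc p
    { σ.loc p with delivered := insert (p, m) (σ.loc p).delivered }
  net := σ.net + sendTo p (G.neighborFinset p) m []

/-- The handler of the reception of `pkt`, when `rest` are the other messages in transit. -/
def onReceive (pkt : Packet V M) (rest : Multiset (Packet V M)) (σ : NetState V M) :
    NetState V M where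
  loc := Function.update σ.loc pkt.dst
    { σ.loc pkt.dst with
      paths := insert (pkt.broadcaster, pkt.payload, pkt.storedPath Vt) (σ.loc pkt.dst).paths }
  net := rest + sendTo pkt.dst
    ((G.neighborFinset pkt.dst).filter (· ∉ removeAllTrusted Vt pkt.fwdPath))
    pkt.payload pkt.fwdPath

/-- The handler of a delivery at `p`. -/
def onDeliver (p s : V) (m : M) (σ : NetState V M) : NetState V M where
  loc := Function.update σ.loc p
    { σ.loc p with delivered := insert (s, m) (σ.loc p).delivered }
  net := σ.net

/-- The steps of the system when `B` is the set of Byzantine nodes. Nodes outside `B` follow the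
protocol; a node of `B` may send anything at any time, but only on its own channels. The variables
of a node of `B` have no meaning. -/
def Step (σ : NetState V M) : Event V M → NetState V M → Prop
  | .broadcast p m, σ' => p ∉ B ∧ σ' = onBroadcast G p m σ
  | .receive pkt, σ' => ∃ rest, σ.net = pkt ::ₘ rest ∧
      σ' = if pkt.dst ∈ B then ⟨σ.loc, rest⟩ else onReceive G Vt pkt rest σ
  | .deliver p s m, σ' => p ∉ B ∧ CanDeliver f (σ.loc p) s m ∧ (s, m) ∉ (σ.loc p).delivered ∧
      σ' = onDeliver p s m σ
  | .byzantineSend pkt, σ' => pkt.src ∈ B ∧ G.Adj pkt.src pkt.dst ∧ σ' = ⟨σ.loc, pkt ::ₘ σ.net⟩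
  | .idle, σ' => σ' = σ

variable (M) in
/-- The executions of the protocol on the asynchronous reliable network `G` with Byzantine nodes
`B`: infinite interleaved runs (idling is allowed) in which a node broadcasts the same message at
most once, every message in transit is eventually received, and no correct process ignores an
enabled delivery forever. -/
structure Execution where
  state : ℕ → NetState V M
  event : ℕ → Event V M
  init : state 0 = initState
  step : ∀ t, Step G Vt f B (state t) (event t) (state (t + 1))
  broadcast_once : ∀ p m t t', event t = .broadcast p m → event t' = .broadcast p m → t = t'
  eventually_received : ∀ t, ∀ pkt ∈ (state t).net, ∃ t', t ≤ t' ∧ event t' = .receive pkt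
  eventually_delivered : ∀ t p s m, p ∉ B → CanDeliver f ((state t).loc p) s m →
    ∃ t', (s, m) ∈ ((state t').loc p).delivered

variable {G Vt f B}

namespace Execution

/-- At time `t`, `s` broadcasts `m`. -/
def BroadcastsAt (E : Execution M G Vt f B) (t : ℕ) (s : V) (m : M) : Prop :=
  E.event t = .broadcast s m

/-- At time `t`, `p` delivers the message `m` of the broadcaster `s`. A broadcaster delivers its own
message when it broadcasts it. -/
def DeliversAt (E : Execution M G Vt f B) (t : ℕ) (p s : V) (m : M) : Prop :=
  E.event t = .deliver p s m ∨ (p = s ∧ E.event t = .broadcast s m)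

/-- If `s` broadcasts a message, then `p` eventually delivers it. -/
def Validity (E : Execution M G Vt f B) (s p : V) : Prop :=
  ∀ t m, E.BroadcastsAt t s m → ∃ t', E.DeliversAt t' p s m

/-- If `p` delivers a message of `s`, then `s` has broadcast it. -/
def NoCreation (E : Execution M G Vt f B) (s p : V) : Prop :=
  ∀ t m, E.DeliversAt t p s m → ∃ t' ≤ t, E.BroadcastsAt t' s m

/-- `p` delivers each message of `s` at most once. -/
def NoDuplication (E : Execution M G Vt f B) (s p : V) : Prop :=
  ∀ t t' m, E.DeliversAt t p s m → E.DeliversAt t' p s m → t = t'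

end Execution

variable (M G Vt f)

/-- RC-Validity between `u` and `v`: in every execution with at most `f` Byzantine nodes, all
untrusted, in which `u` and `v` are correct, each of `u` and `v` eventually delivers every message
broadcast by the other. -/
def ValidityBetween (u v : V) : Prop :=
  ∀ B : Finset V, Disjoint B Vt → B.card ≤ f → u ∉ B → v ∉ B →
    ∀ E : Execution M G Vt f B, E.Validity u v ∧ E.Validity v u

/-- `u` and `v` can communicate reliably: in every execution with at most `f` Byzantine nodes, all
untrusted, in which `u` and `v` are correct, the three properties of reliable communication hold for
the messages from `u` to `v` and for those from `v` to `u`. -/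
def CommunicateReliably (u v : V) : Prop :=
  ∀ B : Finset V, Disjoint B Vt → B.card ≤ f → u ∉ B → v ∉ B →
    ∀ E : Execution M G Vt f B,
      (E.Validity u v ∧ E.NoCreation u v ∧ E.NoDuplication u v) ∧
      (E.Validity v u ∧ E.NoCreation v u ∧ E.NoDuplication v u)

end Protocol

end DolevUT

/-! ### Menger's theorem for nonadjacent nodes, from Hall's theorem. -/

section Menger

open SimpleGraph

variable {V : Type*}

/-! Trusted nodes are correct, are erased from stored paths, and are never skipped in forwarding.
Chains of them therefore act as direct channels, and the edges of `H` are exactly these channels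
between `u`, `v` and the untrusted nodes.

Safety needs no connectivity. Of `f + 1` disjoint stored paths one avoids the at most `f` Byzantine
nodes (`CanDeliver.exists_disjoint_stored`), and a path that avoids them traces back to a genuine
broadcast.

Sufficiency: a link between `u` and `v` yields an empty stored path. Among `2 * f + 1` internally
disjoint paths of `H`, at least `f + 1` avoid the Byzantine nodes, and forwarding along them
(`Execution.Forwards.walk`) leaves disjoint stored paths at the receiver.

Necessity: otherwise Menger's theorem gives at most `2 * f` nodes separating `u` from `v` in `H`,
and the untrusted ones among them separate `u` from `v` in `G`. Make up to `f` of these Byzantine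
and silent (`exists_silent_execution`). Every path stored at `v` then meets the at most `f`
remaining ones (`Execution.exists_mem_of_stored`), so `v` never delivers. This refutes validity
alone, whence both equivalences. -/

theorem SimpleGraph.exists_walk_of_seq (K : SimpleGraph V) (x : ℕ → V) (n : ℕ)
    (h : ∀ i < n, x i = x (i + 1) ∨ K.Adj (x i) (x (i + 1))) :
    ∃ w : K.Walk (x 0) (x n), ∀ y ∈ w.support, ∃ i ≤ n, y = x i := by
  induction n with
  | zero => exact ⟨.nil, by simp⟩
  | succ n ih =>
    obtain ⟨w, hw⟩ := ih fun i hi => h i (by omega)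
    rcases h n (by omega) with h1 | h1
    · refine ⟨w.copy rfl h1, fun y hy => ?_⟩
      rw [Walk.support_copy] at hy
      obtain ⟨i, hi, rfl⟩ := hw y hy
      exact ⟨i, by omega, rfl⟩
    · refine ⟨w.concat h1, fun y hy => ?_⟩
      rw [Walk.support_concat, List.mem_append, List.mem_singleton] at hy
      rcases hy with hy | rfl
      · obtain ⟨i, hi, rfl⟩ := hw y hy
        exact ⟨i, by omega, rfl⟩
      · exact ⟨n + 1, le_rfl, rfl⟩

/-- A permutation of `I ⊕ J` traces disjoint trajectories through `I` that start and end in `J`. -/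
theorem Equiv.Perm.exists_trajectories {I J : Type*} [Finite I] [Finite J]
    (φ : Equiv.Perm (I ⊕ J)) :
    ∃ n : J → ℕ, (∀ a, 0 < n a) ∧ (∀ a, ((φ ^ n a) (Sum.inr a)).isRight) ∧
      (∀ a i, 0 < i → i < n a → ((φ ^ i) (Sum.inr a)).isLeft) ∧
      ∀ a b i j, 0 < i → i < n a → 0 < j → j < n b →
        (φ ^ i) (Sum.inr a) = (φ ^ j) (Sum.inr b) → a = b := by
  classical
  -- The orbit is a cycle, so it comes back to `J` at the latest at `a` itself; the first return
  -- time serves as `n a`.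
  have hex : ∀ a : J, ∃ n, 0 < n ∧ ((φ ^ n) (Sum.inr a)).isRight := fun a =>
    ⟨orderOf φ, orderOf_pos φ, by simp [pow_orderOf_eq_one]⟩
  have hleft : ∀ a i, 0 < i → i < Nat.find (hex a) → ((φ ^ i) (Sum.inr a)).isLeft := by
    intro a i h0 hi
    have := Nat.find_min (hex a) hi
    rw [not_and] at this
    simpa using this h0
  refine ⟨fun a => Nat.find (hex a), fun a => (Nat.find_spec (hex a)).1,
    fun a => (Nat.find_spec (hex a)).2, hleft, ?_⟩
  -- Cancelling `φ ^ i` puts `a` on the trajectory of `b` at time `j - i`, before its first return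
  -- to `J`; hence `j = i`.
  have key : ∀ a b i j, i ≤ j → j < Nat.find (hex b) →
      (φ ^ i) (Sum.inr a) = (φ ^ j) (Sum.inr b) → a = b := by
    intro a b i j hij hj h
    obtain ⟨d, rfl⟩ := Nat.exists_eq_add_of_le hij
    rw [pow_add, Equiv.Perm.mul_apply] at h
    have h1 := (φ ^ i).injective h
    rcases Nat.eq_zero_or_pos d with rfl | hd
    · simpa using h1
    · have := hleft b d hd (by omega)
      rw [← h1] at this
      simp at this
  intro a b i j _ hi _ hj h
  rcases le_total i j with hij | hij
  · exact key a b i j hij hj h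
  · exact (key b a j i hij hi h.symm).symm

/-- Menger's theorem for nonadjacent nodes: there are `k` internally disjoint paths, or fewer than
`k` nodes form the boundary of a set of nodes that separates `u` from `v`. -/
theorem SimpleGraph.exists_disjoint_paths_or_separator [Fintype V] (K : SimpleGraph V) {u v : V}
    (huv : u ≠ v) (hadj : ¬ K.Adj u v) (k : ℕ) :
    (∃ P : Fin k → K.Path u v, Function.Injective P ∧
      ∀ i j, i ≠ j → ∀ x, x ∈ (P i).1.support → x ∈ (P j).1.support → x = u ∨ x = v) ∨
    ∃ (R : Set V) (C : Finset V), u ∈ R ∧ v ∉ R ∧ u ∉ C ∧ v ∉ C ∧ C.card < k ∧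
      ∀ x ∈ R, ∀ y, K.Adj x y → y ∈ R ∨ y ∈ C := by
  classical
  -- Hall's theorem is applied to departures and arrivals: each inner node is one of each, `u` gives
  -- `k` departures and `v` gives `k` arrivals. A perfect matching is a permutation of `I ⊕ Fin k`
  -- whose trajectories from the copies of `u` are the paths; an inner node matched to itself lies
  -- on none.
  let I := {x : V // x ≠ u ∧ x ≠ v}
  let tail : I ⊕ Fin k → V := Sum.elim Subtype.val fun _ => u
  let head : I ⊕ Fin k → V := Sum.elim Subtype.val fun _ => v
  let N : I ⊕ Fin k → Finset (I ⊕ Fin k) := fun a =>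
    Finset.univ.filter fun b => tail a = head b ∨ K.Adj (tail a) (head b)
  have hself : ∀ i : I, Sum.inl i ∈ N (Sum.inl i) := fun i =>
    Finset.mem_filter.2 ⟨Finset.mem_univ _, Or.inl rfl⟩
  by_cases hall : ∀ S : Finset (I ⊕ Fin k), S.card ≤ (S.biUnion N).card
  · left
    obtain ⟨φ, hinj, hφ⟩ := (Finset.all_card_le_biUnion_card_iff_exists_injective N).1 hall
    have hφ : ∀ a, tail a = head (φ a) ∨ K.Adj (tail a) (head (φ a)) := fun a => by
      simpa [N] using hφ a
    obtain ⟨n, hn, hr, hl, hdisj⟩ := Equiv.Perm.exists_trajectories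
      (Equiv.ofBijective φ (Finite.injective_iff_bijective.1 hinj))
    set ψ := Equiv.ofBijective φ (Finite.injective_iff_bijective.1 hinj)
    have hψ : ∀ a, tail a = head (ψ a) ∨ K.Adj (tail a) (head (ψ a)) := hφ
    have hwalk : ∀ a : Fin k, ∃ w : K.Walk u v, ∀ y ∈ w.support, y = u ∨ y = v ∨
        ∃ i, 0 < i ∧ i < n a ∧ y = head ((ψ ^ i) (Sum.inr a)) := by
      intro a
      let x : ℕ → V := fun i => if i = 0 then u else head ((ψ ^ i) (Sum.inr a))
      have hx : ∀ i < n a, x i = tail ((ψ ^ i) (Sum.inr a)) := by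
        intro i hi
        rcases Nat.eq_zero_or_pos i with rfl | h0
        · simp [x, tail]
        · obtain ⟨z, hz⟩ := Sum.isLeft_iff.1 (hl a i h0 hi)
          simp [x, h0.ne', hz, head, tail]
      have hend : x (n a) = v := by
        obtain ⟨z, hz⟩ := Sum.isRight_iff.1 (hr a)
        simp [x, (hn a).ne', hz, head]
      obtain ⟨w, hw⟩ := K.exists_walk_of_seq x (n a) fun i hi => by
        rw [hx i hi]
        simpa [x, pow_succ'] using hψ ((ψ ^ i) (Sum.inr a))
      refine ⟨w.copy (by simp [x]) hend, fun y hy => ?_⟩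
      rw [Walk.support_copy] at hy
      obtain ⟨i, hi, rfl⟩ := hw y hy
      rcases Nat.eq_zero_or_pos i with rfl | h0
      · simp [x]
      · rcases hi.eq_or_lt with rfl | hi
        · exact Or.inr (Or.inl hend)
        · exact Or.inr (Or.inr ⟨i, h0, hi, by simp [x, h0.ne']⟩)
    choose w hw using hwalk
    have hd : ∀ a b, a ≠ b → ∀ x, x ∈ (w a).bypass.support → x ∈ (w b).bypass.support →
        x = u ∨ x = v := by
      intro a b hab x hxa hxb
      by_contra! hx
      obtain ⟨i, hi0, hi, h1⟩ :=
        ((hw a x (Walk.support_bypass_subset_support _ hxa)).resolve_left hx.1).resolve_left hx.2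
      obtain ⟨j, hj0, hj, h2⟩ :=
        ((hw b x (Walk.support_bypass_subset_support _ hxb)).resolve_left hx.1).resolve_left hx.2
      obtain ⟨y, hy⟩ := Sum.isLeft_iff.1 (hl a i hi0 hi)
      obtain ⟨z, hz⟩ := Sum.isLeft_iff.1 (hl b j hj0 hj)
      refine hab (hdisj a b i j hi0 hi hj0 hj ?_)
      rw [hy, hz]
      rw [hy] at h1
      rw [hz] at h2
      exact congrArg Sum.inl (Subtype.ext (h1.symm.trans h2))
    refine ⟨fun a => ⟨(w a).bypass, (w a).bypass_isPath⟩, fun a b hab => ?_, hd⟩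
    -- Two equal paths share all their nodes, so they contain only `u` and `v` and are an edge,
    -- contrary to `hadj`.
    by_contra hne
    have hsub : ∀ x ∈ (w a).bypass.support, x = u ∨ x = v := fun x hx => by
      refine hd a b hne x hx ?_
      have := congrArg Subtype.val hab
      simp only at this
      rwa [← this]
    generalize (w a).bypass = p at hsub
    cases p with
    | nil => exact huv rfl
    | @cons _ y _ h p =>
      rcases hsub y (by simp) with rfl | rfl
      · exact K.irrefl h
      · exact hadj h
  · right
    push Not at hall
    -- The cut `C` will consist of the inner nodes in `N(S)` outside `S`. Inner nodes of `S` lie in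
    -- `N(S)` by `hself`, so `|SI| + |C| ≤ |N(S)| < |S| ≤ |SI| + k`.
    obtain ⟨S, hS⟩ := hall
    let SI : Finset I := Finset.univ.filter fun i => Sum.inl i ∈ S
    have hSle : S ⊆ SI.disjSum (Finset.univ : Finset (Fin k)) := by
      rintro (i | a) h
      · simpa [SI] using h
      · simp
    have hcard : S.card ≤ SI.card + k := by
      simpa using Finset.card_le_card hSle
    have hinl : ∀ i ∈ SI, Sum.inl i ∈ S.biUnion N := fun i hi =>
      Finset.mem_biUnion.2 ⟨_, (Finset.mem_filter.1 hi).2, hself i⟩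
    -- Adjacency to `v` would put all `k` arrivals into `N(S)`, making it at least as large as `S`.
    have hv : ∀ s ∈ S, ¬ K.Adj (tail s) v := by
      intro s hs hsv
      have h1 : SI.disjSum (Finset.univ : Finset (Fin k)) ⊆ S.biUnion N := by
        rintro (i | a) h
        · exact hinl i (by simpa using h)
        · exact Finset.mem_biUnion.2 ⟨s, hs, by simp [N, head, hsv]⟩
      have h2 := Finset.card_le_card h1
      simp at h2
      omega
    have hu : ∃ a : Fin k, Sum.inr a ∈ S := by
      by_contra! hcon
      have h1 : S ⊆ S.biUnion N := by
        rintro (i | a) h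
        · exact hinl i (by simpa [SI] using h)
        · exact absurd h (hcon a)
      exact absurd (Finset.card_le_card h1) (by omega)
    obtain ⟨a, ha⟩ := hu
    let C : Finset I := Finset.univ.filter fun i => Sum.inl i ∈ S.biUnion N ∧ i ∉ SI
    have hC : SI.card + C.card ≤ (S.biUnion N).card := by
      have hdis : Disjoint SI C := Finset.disjoint_left.2 fun i hi hi' =>
        (Finset.mem_filter.1 hi').2.2 hi
      rw [← Finset.card_union_of_disjoint hdis, ← Finset.card_map Function.Embedding.inl]
      refine Finset.card_le_card fun x hx => ?_
      obtain ⟨i, hi, rfl⟩ := Finset.mem_map.1 hx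
      rcases Finset.mem_union.1 hi with hi | hi
      · exact hinl i hi
      · exact (Finset.mem_filter.1 hi).2.1
    refine ⟨{x | ∃ s ∈ S, tail s = x}, C.map (Function.Embedding.subtype _), ⟨_, ha, rfl⟩,
      ?_, ?_, ?_, ?_, ?_⟩
    · rintro ⟨i | b, _, hs⟩
      · exact i.2.2 hs
      · exact huv hs
    · simp
    · simp
    · rw [Finset.card_map]
      omega
    · rintro _ ⟨s, hs, rfl⟩ y hy
      by_cases hyu : y = u
      · exact Or.inl ⟨_, ha, hyu.symm⟩
      by_cases hyv : y = v
      · exact absurd (hyv ▸ hy) (hv s hs)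
      by_cases hySI : (⟨y, hyu, hyv⟩ : I) ∈ SI
      · exact Or.inl ⟨_, (Finset.mem_filter.1 hySI).2, rfl⟩
      · refine Or.inr (Finset.mem_map.2 ⟨⟨y, hyu, hyv⟩, ?_, rfl⟩)
        refine Finset.mem_filter.2 ⟨Finset.mem_univ _, Finset.mem_biUnion.2 ⟨s, hs, ?_⟩, hySI⟩
        simp [N, head, hy]

end Menger

namespace DolevUT

/-! ### The delivery condition and the paths carried by packets. -/

section LocalState

variable {V M : Type*} {f : ℕ}

theorem mem_sendTo {p : V} {D : Finset V} {m : M} {l : List V} {pkt : Packet V M} :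
    pkt ∈ sendTo p D m l ↔ ∃ q ∈ D, pkt = ⟨p, q, m, l⟩ := by
  simp only [sendTo, Multiset.mem_map, Finset.mem_val, eq_comm]

theorem CanDeliver.mono {a b : LocalState V M} (h : a.paths ⊆ b.paths) {s : V} {m : M}
    (hc : CanDeliver f a s m) : CanDeliver f b s m := by
  rcases hc with hc | ⟨P, hi, hP, hd⟩
  · exact Or.inl (h hc)
  · exact Or.inr ⟨P, hi, fun i => h (hP i), hd⟩

/-- Pigeonhole: at most `f` nodes cannot meet `f + 1` disjoint lists. Used with the Byzantine nodes
for no creation, and with the correct part of a cut for necessity. -/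
theorem CanDeliver.exists_disjoint_stored {a : LocalState V M} {s : V} {m : M}
    (hc : CanDeliver f a s m) {C : Finset V} (hC : C.card ≤ f) :
    ∃ l, (s, m, l) ∈ a.paths ∧ ∀ x ∈ l, x ∉ C := by
  rcases hc with hc | ⟨P, hi, hP, hd⟩
  · exact ⟨[], hc, by simp⟩
  · by_contra! hcon
    choose g hg hgC using fun i => hcon (P i) (hP i)
    have hinj : Function.Injective g := by
      intro i j hij
      by_contra hne
      exact hd i j hne (hg i) (hij ▸ hg j)
    have := Finset.card_le_card_of_injOn (s := Finset.univ) (t := C) g (fun i _ => hgC i)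
      hinj.injOn
    simp at this
    omega

theorem Packet.broadcaster_of_path_eq {pkt pk : Packet V M} (h : pkt.path = pk.fwdPath) :
    pkt.broadcaster = pk.broadcaster := by
  cases pkt with
  | mk src dst payload path =>
    simp only [Packet.fwdPath] at h
    subst h
    cases pk with
    | mk s d p path => cases path <;> rfl

theorem Packet.mem_fwdPath_of_path_eq {pkt pk : Packet V M} (h : pkt.path = pk.fwdPath) {x : V} :
    x ∈ pkt.fwdPath ↔ x ∈ pk.fwdPath ∨ x = pkt.src := by
  rw [Packet.fwdPath, h]
  simp

theorem Packet.mem_storedPath [DecidableEq V] {Vt : Finset V} {pkt : Packet V M}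
    {x : V} :
    x ∈ pkt.storedPath Vt ↔ x ∈ pkt.fwdPath ∧ x ∉ Vt ∧ x ≠ pkt.broadcaster := by
  simp only [Packet.storedPath, removeAllTrusted, List.mem_filter, decide_eq_true_eq, and_assoc]

end LocalState

/-! ### Effect of a single step on packets, stored paths and deliveries. -/

section Steps

variable {V M : Type*} [Fintype V] [DecidableEq V] {G : SimpleGraph V} [DecidableRel G.Adj]
  {Vt : Finset V} {f : ℕ} {B : Finset V} {σ σ' : NetState V M} {e : Event V M}

theorem Step.mem_net_or_received (h : Step G Vt f B σ e σ') {pkt : Packet V M}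
    (hp : pkt ∈ σ.net) : pkt ∈ σ'.net ∨ e = .receive pkt := by
  classical
  cases e with
  | broadcast p m =>
    obtain ⟨_, rfl⟩ := h
    exact Or.inl (Multiset.mem_add.2 (Or.inl hp))
  | receive pk =>
    obtain ⟨rest, hr, rfl⟩ := h
    rw [hr, Multiset.mem_cons] at hp
    rcases hp with rfl | hp
    · exact Or.inr rfl
    · left
      split_ifs
      · exact hp
      · exact Multiset.mem_add.2 (Or.inl hp)
  | deliver p s m =>
    obtain ⟨_, _, _, rfl⟩ := h
    exact Or.inl hp
  | byzantineSend pk =>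
    obtain ⟨_, _, rfl⟩ := h
    exact Or.inl (Multiset.mem_cons_of_mem hp)
  | idle =>
    cases h
    exact Or.inl hp

/-- The origins of a message in transit. -/
theorem Step.mem_net_cases (h : Step G Vt f B σ e σ') {pkt : Packet V M} (hp : pkt ∈ σ'.net) :
    pkt ∈ σ.net ∨
    (e = .broadcast pkt.src pkt.payload ∧ pkt.src ∉ B ∧ pkt.path = [] ∧
      G.Adj pkt.src pkt.dst) ∨
    (∃ pk ∈ σ.net, e = .receive pk ∧ pk.dst ∉ B ∧ pkt.src = pk.dst ∧ pkt.payload = pk.payload ∧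
      pkt.path = pk.fwdPath ∧ G.Adj pkt.src pkt.dst) ∨
    (e = .byzantineSend pkt ∧ pkt.src ∈ B ∧ G.Adj pkt.src pkt.dst) := by
  cases e with
  | broadcast p m =>
    obtain ⟨hB, rfl⟩ := h
    rcases Multiset.mem_add.1 hp with hp | hp
    · exact Or.inl hp
    · obtain ⟨q, hq, rfl⟩ := mem_sendTo.1 hp
      exact Or.inr (Or.inl ⟨rfl, hB, rfl, by simpa using hq⟩)
  | receive pk =>
    obtain ⟨rest, hr, rfl⟩ := h
    by_cases hB : pk.dst ∈ B
    · rw [if_pos hB] at hp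
      exact Or.inl (hr ▸ Multiset.mem_cons_of_mem hp)
    · rw [if_neg hB] at hp
      rcases Multiset.mem_add.1 hp with hp | hp
      · exact Or.inl (hr ▸ Multiset.mem_cons_of_mem hp)
      · obtain ⟨q, hq, rfl⟩ := mem_sendTo.1 hp
        refine Or.inr (Or.inr (Or.inl ⟨pk, hr ▸ Multiset.mem_cons_self _ _, rfl, hB, rfl, rfl, rfl,
          ?_⟩))
        simpa using (Finset.mem_filter.1 hq).1
  | deliver p s m =>
    obtain ⟨_, _, _, rfl⟩ := h
    exact Or.inl hp
  | byzantineSend pk =>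
    obtain ⟨hB, ha, rfl⟩ := h
    rcases Multiset.mem_cons.1 hp with rfl | hp
    · exact Or.inr (Or.inr (Or.inr ⟨rfl, hB, ha⟩))
    · exact Or.inl hp
  | idle =>
    cases h
    exact Or.inl hp

theorem Step.mem_paths_cases (h : Step G Vt f B σ e σ') {p s : V} {m : M} {l : List V}
    (hp : (s, m, l) ∈ (σ'.loc p).paths) :
    (s, m, l) ∈ (σ.loc p).paths ∨
    ∃ pk ∈ σ.net, e = .receive pk ∧ pk.dst = p ∧ p ∉ B ∧ s = pk.broadcaster ∧ m = pk.payload ∧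
      l = pk.storedPath Vt := by
  cases e with
  | broadcast q m =>
    obtain ⟨hB, rfl⟩ := h
    by_cases hq : p = q
    · subst hq
      left; simpa [onBroadcast] using hp
    · left; simpa [onBroadcast, hq] using hp
  | receive pk =>
    obtain ⟨rest, hr, rfl⟩ := h
    by_cases hB : pk.dst ∈ B
    · rw [if_pos hB] at hp
      exact Or.inl hp
    · rw [if_neg hB] at hp
      by_cases hq : p = pk.dst
      · subst hq
        simp only [onReceive, Function.update_self, Set.mem_insert_iff, Prod.mk.injEq] at hp
        rcases hp with ⟨h1, h2, h3⟩ | hp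
        · exact Or.inr ⟨pk, hr ▸ Multiset.mem_cons_self _ _, rfl, rfl, hB, h1, h2, h3⟩
        · exact Or.inl hp
      · left; simpa [onReceive, hq] using hp
  | deliver q s m =>
    obtain ⟨_, _, _, rfl⟩ := h
    by_cases hq : p = q
    · subst hq
      left; simpa [onDeliver] using hp
    · left; simpa [onDeliver, hq] using hp
  | byzantineSend pk =>
    obtain ⟨hB, ha, rfl⟩ := h
    exact Or.inl hp
  | idle =>
    cases h
    exact Or.inl hp

theorem Step.mem_delivered_cases (h : Step G Vt f B σ e σ') {p s : V} {m : M}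
    (hp : (s, m) ∈ (σ'.loc p).delivered) :
    (s, m) ∈ (σ.loc p).delivered ∨ e = .deliver p s m ∨ (p = s ∧ e = .broadcast s m) := by
  cases e with
  | broadcast q m' =>
    obtain ⟨hB, rfl⟩ := h
    by_cases hq : p = q
    · subst hq
      simp only [onBroadcast, Function.update_self, Set.mem_insert_iff, Prod.mk.injEq] at hp
      rcases hp with ⟨rfl, rfl⟩ | hp
      · exact Or.inr (Or.inr ⟨rfl, rfl⟩)
      · exact Or.inl hp
    · left; simpa [onBroadcast, hq] using hp
  | receive pk =>
    obtain ⟨rest, hr, rfl⟩ := h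
    by_cases hB : pk.dst ∈ B
    · rw [if_pos hB] at hp
      exact Or.inl hp
    · rw [if_neg hB] at hp
      by_cases hq : p = pk.dst
      · subst hq
        left; simpa [onReceive] using hp
      · left; simpa [onReceive, hq] using hp
  | deliver q s' m' =>
    obtain ⟨_, _, _, rfl⟩ := h
    by_cases hq : p = q
    · subst hq
      simp only [onDeliver, Function.update_self, Set.mem_insert_iff, Prod.mk.injEq] at hp
      rcases hp with ⟨rfl, rfl⟩ | hp
      · exact Or.inr (Or.inl rfl)
      · exact Or.inl hp
    · left; simpa [onDeliver, hq] using hp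
  | byzantineSend pk =>
    obtain ⟨hB, ha, rfl⟩ := h
    exact Or.inl hp
  | idle =>
    cases h
    exact Or.inl hp

theorem Step.loc_mono (h : Step G Vt f B σ e σ') (p : V) :
    (σ.loc p).paths ⊆ (σ'.loc p).paths ∧ (σ.loc p).delivered ⊆ (σ'.loc p).delivered := by
  cases e with
  | broadcast q m =>
    obtain ⟨hB, rfl⟩ := h
    by_cases hq : p = q
    · subst hq; simp [onBroadcast]
    · simp [onBroadcast, hq]
  | receive pk =>
    obtain ⟨rest, hr, rfl⟩ := h
    by_cases hB : pk.dst ∈ B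
    · simp [if_pos hB]
    · rw [if_neg hB]
      by_cases hq : p = pk.dst
      · subst hq; simp [onReceive]
      · simp [onReceive, hq]
  | deliver q s m =>
    obtain ⟨_, _, _, rfl⟩ := h
    by_cases hq : p = q
    · subst hq; simp [onDeliver]
    · simp [onDeliver, hq]
  | byzantineSend pk =>
    obtain ⟨hB, ha, rfl⟩ := h
    simp
  | idle =>
    cases h
    simp

theorem Step.mem_delivered {p s : V} {m : M} (h : Step G Vt f B σ (.deliver p s m) σ') :
    (s, m) ∈ (σ'.loc p).delivered := by
  obtain ⟨_, _, _, rfl⟩ := h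
  simp [onDeliver]

end Steps

/-! ### No duplication and no creation. -/

namespace Execution

variable {V M : Type*} [Fintype V] [DecidableEq V] {G : SimpleGraph V} [DecidableRel G.Adj]
  {Vt : Finset V} {f : ℕ} {B : Finset V} (E : Execution M G Vt f B)

theorem loc_mono {t t' : ℕ} (h : t ≤ t') (p : V) :
    ((E.state t).loc p).paths ⊆ ((E.state t').loc p).paths ∧
      ((E.state t).loc p).delivered ⊆ ((E.state t').loc p).delivered := by
  induction h with
  | refl => exact ⟨subset_rfl, subset_rfl⟩
  | @step k _ ih =>
    have := (E.step k).loc_mono p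
    exact ⟨ih.1.trans this.1, ih.2.trans this.2⟩

theorem noDuplication {u v : V} (huv : u ≠ v) : E.NoDuplication u v := by
  have key : ∀ t t' m, t < t' → E.event t = .deliver v u m → E.event t' ≠ .deliver v u m := by
    intro t t' m hlt h h'
    have h1 := E.step t
    rw [h] at h1
    have h2 := E.step t'
    rw [h'] at h2
    exact h2.2.2.1 ((E.loc_mono hlt v).2 h1.mem_delivered)
  intro t t' m h h'
  have h := h.resolve_right fun h => huv h.1.symm
  have h' := h'.resolve_right fun h => huv h.1.symm
  rcases lt_trichotomy t t' with hlt | heq | hlt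
  · exact absurd h' (key _ _ _ hlt h)
  · exact heq
  · exact absurd h (key _ _ _ hlt h')

/-- The packet is traced back hop by hop: forwarding keeps the claimed broadcaster, and a Byzantine
injection is impossible because the sender itself lies on `fwdPath`. -/
theorem broadcastsAt_of_mem_net {t : ℕ} {pkt : Packet V M} (hp : pkt ∈ (E.state t).net)
    (hB : ∀ x ∈ pkt.fwdPath, x ∉ B) : ∃ t' < t, E.BroadcastsAt t' pkt.broadcaster pkt.payload := by
  induction t generalizing pkt with
  | zero => simp [E.init, initState] at hp
  | succ t ih =>
    rcases (E.step t).mem_net_cases hp with h | ⟨h, _, hpath, _⟩ | ⟨pk, h, _, _, _, h1, h2, _⟩ |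
      ⟨_, h, _⟩
    · obtain ⟨t', ht, h⟩ := ih h hB
      exact ⟨t', by omega, h⟩
    · refine ⟨t, by omega, ?_⟩
      rw [Packet.broadcaster, hpath]
      exact h
    · obtain ⟨t', ht, h⟩ := ih h fun x hx =>
        hB x ((Packet.mem_fwdPath_of_path_eq h2).2 (Or.inl hx))
      refine ⟨t', by omega, ?_⟩
      rwa [Packet.broadcaster_of_path_eq h2, h1]
    · exact absurd h (hB _ (by simp [Packet.fwdPath]))

/-- The nodes erased from the stored path are trusted or equal to `s`, hence correct, so the whole
extended path avoids `B`. -/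
theorem broadcastsAt_of_mem_paths (hBt : Disjoint B Vt) {t : ℕ} {p s : V} (hs : s ∉ B) {m : M}
    {l : List V} (hp : (s, m, l) ∈ ((E.state t).loc p).paths) (hl : ∀ x ∈ l, x ∉ B) :
    ∃ t' < t, E.BroadcastsAt t' s m := by
  induction t with
  | zero => simp [E.init, initState] at hp
  | succ t ih =>
    rcases (E.step t).mem_paths_cases hp with h | ⟨pk, h, _, _, _, rfl, rfl, rfl⟩
    · obtain ⟨t', ht, h⟩ := ih h
      exact ⟨t', by omega, h⟩
    · obtain ⟨t', ht, h⟩ := E.broadcastsAt_of_mem_net h fun x hx hxB => by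
        refine hl x (Packet.mem_storedPath.2 ⟨hx, Finset.disjoint_left.1 hBt hxB, ?_⟩) hxB
        rintro rfl
        exact hs hxB
      exact ⟨t', by omega, h⟩

theorem noCreation (hBt : Disjoint B Vt) (hBf : B.card ≤ f) {u v : V} (hu : u ∉ B) :
    E.NoCreation u v := by
  rintro t m (h | ⟨_, h⟩)
  · have h1 := E.step t
    rw [h] at h1
    obtain ⟨l, hl, hlB⟩ := h1.2.1.exists_disjoint_stored hBf
    obtain ⟨t', ht, h⟩ := E.broadcastsAt_of_mem_paths hBt hu hl hlB
    exact ⟨t', ht.le, h⟩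
  · exact ⟨t, le_rfl, h⟩

/-! ### Propagation along linked pairs and validity. -/

theorem exists_deliversAt {t : ℕ} {p s : V} {m : M}
    (h : (s, m) ∈ ((E.state t).loc p).delivered) : ∃ t', E.DeliversAt t' p s m := by
  induction t with
  | zero => simp [E.init, initState] at h
  | succ t ih =>
    rcases (E.step t).mem_delivered_cases h with h | h
    · exact ih h
    · exact ⟨t, h⟩

theorem event_receive_of_mem_net {t : ℕ} {pkt : Packet V M} (hp : pkt ∈ (E.state t).net)
    (hB : pkt.dst ∉ B) : ∃ t', (pkt.broadcaster, pkt.payload, pkt.storedPath Vt) ∈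
      ((E.state t').loc pkt.dst).paths ∧ ∀ q, G.Adj pkt.dst q →
        q ∉ removeAllTrusted Vt pkt.fwdPath →
          ⟨pkt.dst, q, pkt.payload, pkt.fwdPath⟩ ∈ (E.state t').net := by
  obtain ⟨t', _, he⟩ := E.eventually_received t pkt hp
  have h := E.step t'
  rw [he] at h
  obtain ⟨rest, _, h⟩ := h
  rw [if_neg hB] at h
  refine ⟨t' + 1, ?_, fun q hq hq' => ?_⟩
  · rw [h]
    simp [onReceive]
  · rw [h]
    refine Multiset.mem_add.2 (Or.inr (mem_sendTo.2 ⟨q, ?_, rfl⟩))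
    simpa using ⟨hq, hq'⟩

/-- At some time, `x` sends `[m, l]` to all its neighbours that are not untrusted nodes of `l`. -/
def Forwards (m : M) (x : V) (l : List V) : Prop :=
  ∀ q, G.Adj x q → q ∉ removeAllTrusted Vt l → ∃ t, ⟨x, q, m, l⟩ ∈ (E.state t).net

/-- At some time, the path `l` is stored at `p` for `(s, m)`. -/
def Stores (p s : V) (m : M) (l : List V) : Prop :=
  ∃ t, (s, m, l) ∈ ((E.state t).loc p).paths

variable {E}

theorem BroadcastsAt.forwards {t : ℕ} {u : V} {m : M} (h : E.BroadcastsAt t u m) :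
    E.Forwards m u [] := by
  intro q hq _
  have h1 := E.step t
  rw [show E.event t = _ from h] at h1
  refine ⟨t + 1, ?_⟩
  rw [h1.2]
  exact Multiset.mem_add.2 (Or.inr (mem_sendTo.2 ⟨q, by simpa using hq, rfl⟩))

theorem Forwards.step {m : M} {x y : V} {l : List V} (h : E.Forwards m x l) (hxy : G.Adj x y)
    (hy : y ∉ removeAllTrusted Vt l) (hB : y ∉ B) :
    E.Forwards m y (l ++ [x]) ∧
      E.Stores y (l.headD x) m ((removeAllTrusted Vt (l ++ [x])).filter (· ≠ l.headD x)) := by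
  obtain ⟨t, ht⟩ := h y hxy hy
  obtain ⟨t', h1, h2⟩ := E.event_receive_of_mem_net ht hB
  exact ⟨fun q hq hq' => ⟨t', h2 q hq hq'⟩, t', h1⟩

/-- Trusted relays leave no trace in the filtered path and are never excluded as recipients, even
when the chain revisits one; the outcome at `y` is that of a direct hop. -/
theorem Forwards.linked {m : M} {x y : V} {l : List V} (h : E.Forwards m x l)
    (hBt : Disjoint B Vt) (hxy : Linked G Vt x y)
    (hy : y ∉ removeAllTrusted Vt (l ++ [x])) (hB : y ∉ B) :
    ∃ l', E.Forwards m y l' ∧ l'.headD y = l.headD x ∧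
      removeAllTrusted Vt l' = removeAllTrusted Vt (l ++ [x]) ∧
      E.Stores y (l.headD x) m ((removeAllTrusted Vt (l ++ [x])).filter (· ≠ l.headD x)) := by
  have hhead : ∀ a z : V, ∀ l : List V, (l ++ [a]).headD z = l.headD a := by
    intro a z l
    cases l <;> rfl
  have hyl : y ∉ removeAllTrusted Vt l := by
    simp only [removeAllTrusted, List.filter_append, List.mem_append] at hy ⊢
    tauto
  rcases hxy with hxy | ⟨n, t, ht, h0, hn, hs⟩
  · obtain ⟨h1, h2⟩ := h.step hxy hyl hB
    exact ⟨_, h1, hhead _ _ _, rfl, h2⟩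
  · have hnot : ∀ i ≤ n, t i ∉ B ∧ ∀ l, t i ∉ removeAllTrusted Vt l := fun i hi =>
      ⟨Finset.disjoint_right.1 hBt (ht i hi), fun l => by simp [removeAllTrusted, ht i hi]⟩
    have key : ∀ i ≤ n, ∃ l', E.Forwards m (t i) l' ∧ l'.headD (t i) = l.headD x ∧
        removeAllTrusted Vt l' = removeAllTrusted Vt (l ++ [x]) := by
      intro i
      induction i with
      | zero =>
        intro hi
        exact ⟨_, (h.step h0 ((hnot 0 hi).2 _) (hnot 0 hi).1).1, hhead _ _ _, rfl⟩
      | succ i ih =>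
        intro hi
        obtain ⟨l', h1, h2, h3⟩ := ih (by omega)
        refine ⟨_, (h1.step (hs i hi) ((hnot _ hi).2 _) (hnot _ hi).1).1,
          (hhead _ _ _).trans h2, ?_⟩
        rw [← h3]
        simp [removeAllTrusted, ht i (by omega)]
    obtain ⟨l', h1, h2, h3⟩ := key n le_rfl
    obtain ⟨h4, h5⟩ := h1.step hn (h3 ▸ hy) hB
    have h6 : removeAllTrusted Vt (l' ++ [t n]) = removeAllTrusted Vt (l ++ [x]) := by
      rw [← h3]
      simp [removeAllTrusted, ht n le_rfl]
    rw [h2, h6] at h5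
    exact ⟨_, h4, (hhead _ _ _).trans h2, h6, h5⟩

/-- Since `w` is a path, the untrusted nodes recorded so far are off the rest of it, so the next
node is never excluded as a recipient. An upper bound on the nodes of `L` is enough for disjointness
later. -/
theorem Forwards.walk {K : SimpleGraph V} (hK : ∀ x y, K.Adj x y → Linked G Vt x y)
    (hBt : Disjoint B Vt) {m : M} {u x v : V} (w : K.Walk x v) (hw : w.IsPath) (hxv : x ≠ v)
    (hB : ∀ y ∈ w.support, y ∉ B) {l : List V} (h : E.Forwards m x l) (hu : l.headD x = u)
    (hl : ∀ y ∈ removeAllTrusted Vt l, y ∉ w.support) :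
    ∃ L, E.Stores v u m L ∧ ∀ y ∈ L, y ∉ Vt ∧ (y ∈ removeAllTrusted Vt l ∨ y ∈ w.support) := by
  induction w generalizing l with
  | nil => exact absurd rfl hxv
  | @cons x y v hxy w ih =>
    rw [SimpleGraph.Walk.cons_isPath_iff] at hw
    have hmem : ∀ z ∈ removeAllTrusted Vt (l ++ [x]), z ∉ Vt ∧
        (z ∈ removeAllTrusted Vt l ∨ z = x) := by
      intro z hz
      simp only [removeAllTrusted, List.mem_filter, List.mem_append, List.mem_singleton,
        decide_eq_true_eq] at hz ⊢
      tauto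
    have hnot : ∀ z ∈ removeAllTrusted Vt (l ++ [x]), z ∉ w.support := by
      intro z hz hzw
      rcases (hmem z hz).2 with h | rfl
      · exact hl z h (by simp [hzw])
      · exact hw.2 hzw
    obtain ⟨l', h1, h2, h3, h4⟩ := h.linked hBt (hK _ _ hxy)
      (fun hy => hnot y hy w.start_mem_support) (hB y (by simp))
    rw [hu] at h4 h2
    by_cases hyv : y = v
    · subst hyv
      refine ⟨_, h4, fun z hz => ?_⟩
      obtain ⟨h5, h6⟩ := hmem z (List.mem_filter.1 hz).1
      exact ⟨h5, h6.imp_right fun h => by simp [h]⟩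
    · obtain ⟨L, hL, hL'⟩ := ih hw.1 hyv (fun z hz => hB z (by simp [hz])) h1 h2 (h3 ▸ hnot)
      refine ⟨L, hL, fun z hz => ?_⟩
      obtain ⟨h5, h6⟩ := hL' z hz
      rw [h3] at h6
      refine ⟨h5, ?_⟩
      rcases h6 with h6 | h6
      · exact (hmem z h6).2.imp_right fun h => by simp [h]
      · right; simp [h6]

/-- Finitely many stored paths are stored simultaneously. -/
theorem Stores.exists_canDeliver {ι : Type*} {p s : V} {m : M} (P : ι → List V)
    (hP : ∀ i, E.Stores p s m (P i)) (hd : ∀ i j, i ≠ j → (P i).Disjoint (P j))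
    (a : Fin (f + 1) → ι) (ha : Function.Injective a) :
    ∃ t, CanDeliver f ((E.state t).loc p) s m := by
  choose t ht using hP
  by_cases hempty : ∃ i, P i = []
  · obtain ⟨i, hi⟩ := hempty
    exact ⟨t i, Or.inl (hi ▸ ht i)⟩
  -- Stored paths persist, so the latest of the storage times serves for all. Disjoint nonempty
  -- lists are distinct.
  · refine ⟨Finset.univ.sup (t ∘ a), Or.inr ⟨P ∘ a, fun i j hij => ?_, fun i => ?_,
      fun i j hij => hd _ _ fun h => hij (ha h)⟩⟩
    · by_contra hne
      have h := hd (a i) (a j) fun h => hne (ha h)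
      simp only [Function.comp_apply] at hij
      rw [← hij] at h
      exact hempty ⟨_, List.eq_nil_iff_forall_not_mem.2 fun x hx => h hx hx⟩
    · exact (E.loc_mono (Finset.le_sup (f := t ∘ a) (Finset.mem_univ i)) p).1 (ht (a i))

/-- The only nodes that two of the paths share are `u` and `v`; being trusted, these are absent from
the stored lists, which are thus disjoint. -/
theorem validity_of_paths {K : SimpleGraph V} (hK : ∀ x y, K.Adj x y → Linked G Vt x y)
    (hBt : Disjoint B Vt) {u v : V} (hu : u ∈ Vt) (hv : v ∈ Vt) (huv : u ≠ v)
    {ι : Type*} (P : ι → K.Path u v) (hB : ∀ i, ∀ x ∈ (P i).1.support, x ∉ B)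
    (hd : ∀ i j, i ≠ j → ∀ x, x ∈ (P i).1.support → x ∈ (P j).1.support → x = u ∨ x = v)
    (a : Fin (f + 1) → ι) (ha : Function.Injective a) : E.Validity u v := by
  intro t m hb
  have hst : ∀ i, ∃ L, E.Stores v u m L ∧ ∀ y ∈ L, y ∉ Vt ∧ y ∈ (P i).1.support := by
    intro i
    obtain ⟨L, h1, h2⟩ := hb.forwards.walk hK hBt (P i).1 (P i).2 huv (hB i) rfl
      (by simp [removeAllTrusted])
    refine ⟨L, h1, fun y hy => ⟨(h2 y hy).1, (h2 y hy).2.resolve_left ?_⟩⟩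
    simp [removeAllTrusted]
  choose L hL hL' using hst
  obtain ⟨t1, h1⟩ := Stores.exists_canDeliver L hL (fun i j hij x hx hx' => by
    rcases hd i j hij x (hL' i x hx).2 (hL' j x hx').2 with rfl | rfl
    · exact (hL' i _ hx).1 hu
    · exact (hL' i _ hx).1 hv) a ha
  obtain ⟨t2, h2⟩ := E.eventually_delivered t1 v u m (Finset.disjoint_right.1 hBt hv) h1
  exact E.exists_deliversAt h2

/-- A direct link suffices: the empty path is stored. -/
theorem validity_of_linked (hBt : Disjoint B Vt) {u v : V} (hu : u ∈ Vt) (hv : v ∈ Vt)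
    (h : Linked G Vt u v) : E.Validity u v := by
  intro t m hb
  obtain ⟨l, _, _, _, t1, h1⟩ := hb.forwards.linked hBt h (by simp [removeAllTrusted, hu])
    (Finset.disjoint_right.1 hBt hv)
  obtain ⟨t2, h2⟩ := E.eventually_delivered t1 v u m (Finset.disjoint_right.1 hBt hv)
    (Or.inl (by simpa [removeAllTrusted, hu] using h1))
  exact E.exists_deliversAt h2

end Execution

end DolevUT

namespace DolevUT

/-! ### Fair executions with silent Byzantine nodes. -/

section SilentExecution

/-- A sequence that contains every reception of a message with payload `m` and every delivery of
`m` infinitely often. -/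
theorem exists_fair_schedule {V M : Type*} [Fintype V] (m : M) (u : V) :
    ∃ act : ℕ → Event V M,
    (∀ t, (∃ pkt, act t = .receive pkt) ∨ ∃ p s, act t = .deliver p s m) ∧
    (∀ t pkt, pkt.payload = m → ∃ t' ≥ t, act t' = .receive pkt) ∧
    ∀ t p s, ∃ t' ≥ t, act t' = .deliver p s m := by
  -- The payload is fixed to `m` because `M` may be uncountable; the remaining data of the events
  -- are countable.
  have : Nonempty (V × V × List V ⊕ V × V) := ⟨Sum.inr (u, u)⟩
  obtain ⟨g, hg⟩ := exists_surjective_nat (V × V × List V ⊕ V × V)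
  let ev : V × V × List V ⊕ V × V → Event V M :=
    Sum.elim (fun x => .receive ⟨x.1, x.2.1, m, x.2.2⟩) fun x => .deliver x.1 x.2 m
  have hev : ∀ x t, ∃ t' ≥ t, ev (g (Nat.unpair t').1) = ev x := by
    intro x t
    obtain ⟨n, rfl⟩ := hg x
    exact ⟨Nat.pair n t, Nat.right_le_pair n t, by simp⟩
  refine ⟨fun t => ev (g (Nat.unpair t).1), fun t => ?_, ?_, fun t p s => hev (Sum.inr (p, s)) t⟩
  · dsimp only
    rcases g (Nat.unpair t).1 with x | x
    · exact Or.inl ⟨_, rfl⟩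
    · exact Or.inr ⟨_, _, rfl⟩
  · rintro t ⟨src, dst, payload, path⟩ rfl
    exact hev (Sum.inl (src, dst, path)) t

variable {V M : Type*} [Fintype V] [DecidableEq V] (G : SimpleGraph V) [DecidableRel G.Adj]
  (Vt : Finset V) (f : ℕ) (B : Finset V)

/-- Every schedule has a run that performs each scheduled event if it is enabled and idles
otherwise. -/
theorem exists_run (act : ℕ → Event V M) : ∃ (state : ℕ → NetState V M) (event : ℕ → Event V M),
    state 0 = initState ∧ (∀ t, Step G Vt f B (state t) (event t) (state (t + 1))) ∧
    (∀ t, event t = act t ∨ event t = .idle) ∧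
    ∀ t, (∃ σ', Step G Vt f B (state t) (act t) σ') → event t = act t := by
  have hnext : ∀ (σ : NetState V M) (e : Event V M), ∃ (e' : Event V M) (σ' : NetState V M),
      Step G Vt f B σ e' σ' ∧ (e' = e ∨ e' = .idle) ∧
        ((∃ σ', Step G Vt f B σ e σ') → e' = e) := by
    intro σ e
    by_cases h : ∃ σ', Step G Vt f B σ e σ'
    · exact ⟨e, h.choose, h.choose_spec, Or.inl rfl, fun _ => rfl⟩
    · exact ⟨.idle, σ, rfl, Or.inr rfl, fun h' => absurd h' h⟩
  choose nextEvent nextState h1 h2 h3 using hnext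
  let state : ℕ → NetState V M := Nat.rec initState fun t σ => nextState σ (act t)
  exact ⟨state, fun t => nextEvent (state t) (act t), rfl, fun t => h1 _ _, fun t => h2 _ _,
    fun t => h3 _ _⟩

/-- There is an execution in which `u` broadcasts `m`, no other broadcast takes place, and the
Byzantine nodes are silent. -/
theorem exists_silent_execution {u : V} (hu : u ∉ B) (m : M) : ∃ E : Execution M G Vt f B,
    E.event 0 = .broadcast u m ∧ (∀ p a t, E.event t = .broadcast p a → p = u ∧ a = m) ∧
    ∀ t pkt, E.event t ≠ .byzantineSend pkt := by
  obtain ⟨act, hact, hrec, hdel⟩ := exists_fair_schedule m u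
  obtain ⟨state, event, h0, hstep, hev, hen⟩ := exists_run G Vt f B fun t =>
    Nat.casesOn t (.broadcast u m) act
  have hevent0 : event 0 = .broadcast u m := hen 0 ⟨_, hu, rfl⟩
  have hsucc : ∀ t, event (t + 1) = .idle ∨ (∃ pkt, event (t + 1) = .receive pkt) ∨
      ∃ p s, event (t + 1) = .deliver p s m := by
    intro t
    rcases hev (t + 1) with h | h
    · rw [h]
      exact Or.inr (hact t)
    · exact Or.inl h
  have hbr : ∀ p a t, event t = .broadcast p a → t = 0 ∧ p = u ∧ a = m := by
    rintro p a (_ | t) h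
    · rw [hevent0] at h
      cases h
      exact ⟨rfl, rfl, rfl⟩
    · rcases hsucc t with h' | ⟨_, h'⟩ | ⟨_, _, h'⟩ <;> rw [h'] at h <;> cases h
  have hbyz : ∀ t pkt, event t ≠ .byzantineSend pkt := by
    rintro (_ | t) pkt h
    · rw [hevent0] at h
      cases h
    · rcases hsucc t with h' | ⟨_, h'⟩ | ⟨_, _, h'⟩ <;> rw [h'] at h <;> cases h
  -- The schedule is fair for the payload `m` only; `hpay` and `hpaths` show that no other payload
  -- occurs.
  have hpay : ∀ t, ∀ pkt ∈ (state t).net, pkt.payload = m := by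
    intro t
    induction t with
    | zero => simp [h0, initState]
    | succ t ih =>
      intro pkt hp
      rcases (hstep t).mem_net_cases hp with h | ⟨h, _⟩ | ⟨pk, h, _, _, _, h', _⟩ | ⟨h, _⟩
      · exact ih _ h
      · exact (hbr _ _ _ h).2.2
      · exact h'.trans (ih _ h)
      · exact absurd h (hbyz _ _)
  have hpaths : ∀ t p s a l, (s, a, l) ∈ ((state t).loc p).paths → a = m := by
    intro t
    induction t with
    | zero => simp [h0, initState]
    | succ t ih =>
      intro p s a l hp
      rcases (hstep t).mem_paths_cases hp with h | ⟨pk, h, _, _, _, _, rfl, _⟩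
      · exact ih _ _ _ _ h
      · exact hpay _ _ h
  have hmono : ∀ t t' p, t ≤ t' → ((state t).loc p).paths ⊆ ((state t').loc p).paths := by
    intro t t' p h
    induction h with
    | refl => exact subset_rfl
    | @step k _ ih => exact ih.trans ((hstep k).loc_mono p).1
  refine ⟨⟨state, event, h0, hstep, ?_, ?_, ?_⟩, hevent0, fun p a t h => (hbr p a t h).2, hbyz⟩
  · intro p a t t' h h'
    rw [(hbr _ _ _ h).1, (hbr _ _ _ h').1]
  · intro t pkt hp
    obtain ⟨t', ht', h⟩ := hrec t pkt (hpay _ _ hp)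
    -- A packet that is never received stays in transit, so its reception is enabled when the
    -- schedule reaches it. The times are shifted by one because time `0` is the broadcast.
    by_contra! hcon
    have hin : ∀ k, t ≤ k → pkt ∈ (state k).net := by
      intro k hk
      induction hk with
      | refl => exact hp
      | @step k hk ih =>
        exact ((hstep k).mem_net_or_received ih).resolve_right (hcon k hk)
    obtain ⟨rest, hrest⟩ := Multiset.exists_cons_of_mem (hin (t' + 1) (by omega))
    have hact' : event (t' + 1) = act t' := hen (t' + 1) (by
      simp only [h]
      exact ⟨_, rest, hrest, rfl⟩)
    exact hcon (t' + 1) (by omega) (hact'.trans h)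
  · intro t p s a hp hc
    have ha : a = m := by
      rcases hc with hc | ⟨P, _, hP, _⟩
      · exact hpaths _ _ _ _ _ hc
      · exact hpaths _ _ _ _ _ (hP 0)
    subst ha
    obtain ⟨t', ht', h⟩ := hdel t p s
    by_contra! hcon
    have hact' : event (t' + 1) = act t' := hen (t' + 1) (by
      simp only [h]
      exact ⟨_, hp, hc.mono (hmono _ _ p (by omega)), hcon _, rfl⟩)
    have hs := hstep (t' + 1)
    rw [hact', h] at hs
    exact hcon _ hs.mem_delivered

variable {G Vt f B}

/-- In an execution without Byzantine messages and with the broadcaster `u` only, let the set `Z`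
of nodes contain `u` and be closed under the neighbours outside the set `C` of untrusted nodes. Then
every path stored outside `Z` meets `C` in a correct node. -/
theorem Execution.exists_mem_of_stored (E : Execution M G Vt f B) {u : V} (hu : u ∈ Vt)
    (hbr : ∀ p a t, E.event t = .broadcast p a → p = u)
    (hbyz : ∀ t pkt, E.event t ≠ .byzantineSend pkt) {Z : Set V} {C : Finset V} (huZ : u ∈ Z)
    (hCt : Disjoint C Vt) (hZ : ∀ x ∈ Z, ∀ y, G.Adj x y → y ∉ C → y ∈ Z) {t : ℕ} {p s : V} {m : M}
    {l : List V} (hpZ : p ∉ Z) (hpC : p ∉ C) (h : (s, m, l) ∈ ((E.state t).loc p).paths) :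
    ∃ x ∈ l, x ∈ C \ B := by
  -- Silent nodes of `B` forward nothing, so they occur on no path; and a message can leave `Z` only
  -- through `C`.
  have hnet : ∀ t, ∀ pkt ∈ (E.state t).net, pkt.broadcaster = u ∧ G.Adj pkt.src pkt.dst ∧
      (∀ x ∈ pkt.fwdPath, x ∉ B) ∧ ((∀ x ∈ pkt.fwdPath, x ∉ C) → pkt.src ∈ Z) := by
    intro t
    induction t with
    | zero => simp [E.init, initState]
    | succ t ih =>
      intro pkt hp
      rcases (E.step t).mem_net_cases hp with h | ⟨h, hB, hpath, ha⟩ |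
        ⟨pk, h, _, hB, h1, h2, h3, ha⟩ | ⟨h, _⟩
      · exact ih _ h
      · have := hbr _ _ _ h
        refine ⟨?_, ha, ?_, fun _ => this ▸ huZ⟩
        · simp [Packet.broadcaster, hpath, this]
        · simpa [Packet.fwdPath, hpath] using hB
      · obtain ⟨i1, i2, i3, i4⟩ := ih _ h
        refine ⟨(Packet.broadcaster_of_path_eq h3).trans i1, ha, fun x hx => ?_, fun hC => ?_⟩
        · rcases (Packet.mem_fwdPath_of_path_eq h3).1 hx with hx | rfl
          · exact i3 x hx
          · exact h1 ▸ hB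
        · rw [h1]
          refine hZ _ (i4 fun x hx => hC x ((Packet.mem_fwdPath_of_path_eq h3).2 (Or.inl hx))) _
            i2 ?_
          exact h1 ▸ hC _ ((Packet.mem_fwdPath_of_path_eq h3).2 (Or.inr rfl))
      · exact absurd h (hbyz _ _)
  induction t with
  | zero => simp [E.init, initState] at h
  | succ t ih =>
    rcases (E.step t).mem_paths_cases h with h | ⟨pk, hpk, _, rfl, _, rfl, rfl, rfl⟩
    · exact ih h
    · obtain ⟨h1, h2, h3, h4⟩ := hnet _ _ hpk
      by_contra! hcon
      -- A node of `C` on the extended path survives in the stored one: it is untrusted, and differs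
      -- from the broadcaster `u`, which is trusted.
      refine hpZ (hZ _ (h4 fun x hx hxC => ?_) _ h2 hpC)
      have hxt := Finset.disjoint_left.1 hCt hxC
      refine hcon x (Packet.mem_storedPath.2 ⟨hx, hxt, ?_⟩) (Finset.mem_sdiff.2 ⟨hxC, h3 x hx⟩)
      rw [h1]
      rintro rfl
      exact hxt hu

end SilentExecution

/-! ### The graph `H`, its connectivity, and the equivalence. -/

section Main

variable {V : Type*} {G : SimpleGraph V} {Vt : Finset V}

theorem Linked.trans_adj {x y z : V} (h : Linked G Vt x y) (hy : y ∈ Vt) (hyz : G.Adj y z) :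
    Linked G Vt x z := by
  rcases h with h | ⟨n, t, ht, h0, hn, hs⟩
  · exact Or.inr ⟨0, fun _ => y, fun _ _ => hy, h, hyz, by simp⟩
  · refine Or.inr ⟨n + 1, fun i => if i ≤ n then t i else y, fun i hi => ?_, by simpa using h0,
      by simpa using hyz, fun i hi => ?_⟩
    · dsimp only
      split_ifs with h
      · exact ht i h
      · exact hy
    · rcases (Nat.lt_succ_iff.1 hi).lt_or_eq with h | rfl
      · simpa [h.le, Nat.succ_le_iff.2 h] using hs i h
      · simpa using hn

/-- This form is symmetric in `u` and `v` and is all that is used of the construction of `H`. -/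
theorem insertTrusted_insertTrusted_adj {u v : V} (hu : u ∈ Vt) (hv : v ∈ Vt) (huv : u ≠ v)
    {x y : V} : (insertTrusted G Vt (insertTrusted G Vt (untrustedGraph G Vt) u) v).Adj x y ↔
      (x ∉ Vt ∨ x = u ∨ x = v) ∧ (y ∉ Vt ∨ y = u ∨ y = v) ∧ x ≠ y ∧ Linked G Vt x y := by
  have hsymm : Linked G Vt x y ↔ Linked G Vt y x := ⟨Linked.symm, Linked.symm⟩
  simp only [insertTrusted, untrustedGraph, Set.mem_union, Set.mem_ofPred_eq, Set.mem_singleton_iff]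
  by_cases hxu : x = u <;> by_cases hxv : x = v <;> by_cases hyu : y = u <;>
    by_cases hyv : y = v <;> simp_all <;>
    rintro - - rfl <;> contradiction

theorem HasDisjointPaths.mono {H : (⊤ : SimpleGraph V).Subgraph} {u v : V} {k l : ℕ}
    (h : HasDisjointPaths H u v k) (hl : l ≤ k) : HasDisjointPaths H u v l := by
  obtain ⟨P, hi, hd⟩ := h
  exact ⟨P ∘ Fin.castLE hl, hi.comp (Fin.castLE_injective hl), fun i j hij =>
    hd _ _ fun h => hij (Fin.castLE_injective hl h)⟩

theorem HasDisjointPaths.symm {H : (⊤ : SimpleGraph V).Subgraph} {u v : V} {k : ℕ}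
    (h : HasDisjointPaths H u v k) : HasDisjointPaths H v u k := by
  obtain ⟨P, hi, hd⟩ := h
  refine ⟨fun i => (P i).reverse, fun i j hij => hi ?_, fun i j hij x hx hx' => ?_⟩
  · have := congrArg SimpleGraph.Path.reverse hij
    simpa [SimpleGraph.Path.reverse] using this
  · simp only [SimpleGraph.Path.reverse_coe, SimpleGraph.Walk.support_reverse,
      List.mem_reverse] at hx hx'
    exact (hd i j hij x hx hx').symm

/-- The possible numbers of paths are closed downwards, so if `k + 1` is not among them, all are at
most `k`, and so is the supremum. -/
theorem le_vertexConnectivity {H : (⊤ : SimpleGraph V).Subgraph} {u v : V} {k : ℕ} :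
    ((k + 1 : ℕ) : ℕ∞) ≤ vertexConnectivity H u v ↔ HasDisjointPaths H u v (k + 1) := by
  refine ⟨fun h => ?_, fun h => le_iSup₂_of_le (k + 1) h le_rfl⟩
  by_contra hcon
  have : vertexConnectivity H u v ≤ (k : ℕ∞) := by
    refine iSup₂_le fun l hl => ?_
    by_contra hlt
    rw [Nat.cast_le] at hlt
    exact hcon (hl.mono (by omega))
  have h := h.trans this
  rw [Nat.cast_le] at h
  omega

/-- Of `2 * f + 1` paths that are internally disjoint, at least `f + 1` avoid `f` given nodes. -/
theorem exists_avoiding_paths {f : ℕ} {K : SimpleGraph V} {u v : V}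
    (P : Fin (2 * f + 1) → K.Path u v)
    (hd : ∀ i j, i ≠ j → ∀ x, x ∈ (P i).1.support → x ∈ (P j).1.support → x = u ∨ x = v)
    {B : Finset V} (hB : B.card ≤ f) (hu : u ∉ B) (hv : v ∉ B) :
    ∃ a : Fin (f + 1) → {i // ∀ x ∈ (P i).1.support, x ∉ B}, Function.Injective a := by
  classical
  let bad : Finset (Fin (2 * f + 1)) :=
    Finset.univ.filter fun i => ∃ x ∈ (P i).1.support, x ∈ B
  -- Choosing a node of `B` on each bad path is injective, since a shared node would be `u` or `v`,
  -- which are not in `B`.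
  have hbad : bad.card ≤ B.card := by
    have hex : ∀ i ∈ bad, ∃ x ∈ (P i).1.support, x ∈ B := fun i hi => (Finset.mem_filter.1 hi).2
    choose g hg hgB using hex
    refine Finset.card_le_card_of_injOn (fun i => if h : i ∈ bad then g i h else u)
      (fun i hi => ?_) fun i hi j hj hij => ?_
    · have hi : i ∈ bad := hi
      simpa [hi] using hgB i hi
    · have hi : i ∈ bad := hi
      have hj : j ∈ bad := hj
      simp only [hi, hj, dif_pos] at hij
      by_contra hne
      rcases hd i j hne _ (hg i hi) (hij ▸ hg j hj) with h | h
      · exact hu (h ▸ hgB i hi)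
      · exact hv (h ▸ hgB i hi)
  have hcard : Fintype.card (Fin (f + 1)) ≤
      Fintype.card {i // ∀ x ∈ (P i).1.support, x ∉ B} := by
    have h1 : (Finset.univ.filter fun i => ∀ x ∈ (P i).1.support, x ∉ B) = badᶜ := by
      ext i
      simp [bad]
    rw [Fintype.card_subtype, h1, Finset.card_compl, Fintype.card_fin, Fintype.card_fin]
    omega
  obtain ⟨a⟩ := Function.Embedding.nonempty_of_card_le hcard
  exact ⟨a, a.injective⟩

variable {M : Type*} [Fintype V] [DecidableEq V] [DecidableRel G.Adj] {f : ℕ}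

/-- Sufficiency of the connectivity condition, for the messages from `u` to `v`. -/
theorem Execution.validity_of_connectivity {H : (⊤ : SimpleGraph V).Subgraph} {u v : V}
    (hK : ∀ x y, H.Adj x y → Linked G Vt x y) (hu : u ∈ Vt) (hv : v ∈ Vt) (huv : u ≠ v)
    (h : H.Adj u v ∨ HasDisjointPaths H u v (2 * f + 1)) {B : Finset V} (hBt : Disjoint B Vt)
    (hBf : B.card ≤ f) (E : Execution M G Vt f B) : E.Validity u v := by
  rcases h with h | ⟨P, -, hd⟩
  · exact E.validity_of_linked hBt hu hv (hK _ _ h)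
  · obtain ⟨a, ha⟩ := exists_avoiding_paths P hd hBf (Finset.disjoint_right.1 hBt hu)
      (Finset.disjoint_right.1 hBt hv)
    exact Execution.validity_of_paths (K := H.spanningCoe) (fun x y h => hK x y (by simpa using h))
      hBt hu hv huv (fun i : {i // ∀ x ∈ (P i).1.support, x ∉ B} => P i.1) (fun i => i.2)
      (fun i j hij => hd _ _ fun h => hij (Subtype.ext h)) a ha

/-- Necessity of the connectivity condition. -/
theorem ValidityBetween.connectivity [Nonempty M] {H : (⊤ : SimpleGraph V).Subgraph} {u v : V}
    (hu : u ∈ Vt) (hv : v ∈ Vt) (huv : u ≠ v)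
    (hH : ∀ x y, H.Adj x y ↔
      (x ∉ Vt ∨ x = u ∨ x = v) ∧ (y ∉ Vt ∨ y = u ∨ y = v) ∧ x ≠ y ∧ Linked G Vt x y)
    (h : ValidityBetween M G Vt f u v) : H.Adj u v ∨ HasDisjointPaths H u v (2 * f + 1) := by
  by_contra! hcon
  obtain ⟨R, C, huR, hvR, huC, hvC, hC, hR⟩ :=
    (H.spanningCoe.exists_disjoint_paths_or_separator huv (by simpa using hcon.1)
      (2 * f + 1)).resolve_left hcon.2
  simp only [SimpleGraph.Subgraph.spanningCoe_adj] at hR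
  -- Trusted nodes in `C` are isolated in `H`, as `u` and `v` are not in `C`; they can be dropped
  -- from the cut.
  let C' := C.filter (· ∉ Vt)
  have hC't : Disjoint C' Vt := Finset.disjoint_left.2 fun x hx => (Finset.mem_filter.1 hx).2
  have hC'card : C'.card ≤ 2 * f :=
    (Finset.card_filter_le _ _).trans (Nat.lt_succ_iff.1 hC)
  -- As `C'` has at most `2 * f` nodes, at most `f` of them remain correct.
  obtain ⟨B, hBC, hBcard⟩ := Finset.exists_subset_card_eq (min_le_right f C'.card)
  have hBt : Disjoint B Vt := hC't.mono_left hBC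
  have huB := Finset.disjoint_right.1 hBt hu
  have hvB := Finset.disjoint_right.1 hBt hv
  -- The side of `u` in `G`: `u` and the untrusted nodes of `R`, with the trusted nodes linked to
  -- them. Other trusted nodes of `R` are left out, since `R` says nothing about their edges in `G`.
  let Z : Set V := {x | (x ∈ R ∧ (x ∉ Vt ∨ x = u)) ∨
    (x ∈ Vt ∧ ∃ r ∈ R, (r ∉ Vt ∨ r = u) ∧ Linked G Vt r x)}
  have hvZ : v ∉ Z := by
    rintro (h | ⟨_, r, hr, hr', hl⟩)
    · exact hvR h.1
    · have hrv : r ≠ v := fun h => hvR (h ▸ hr)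
      exact (hR r hr v ((hH _ _).2 ⟨by tauto, by tauto, hrv, hl⟩)).elim hvR hvC
  have hZ : ∀ x ∈ Z, ∀ y, G.Adj x y → y ∉ C' → y ∈ Z := by
    intro x hx y hxy hy
    obtain ⟨r, hr, hr', hl⟩ : ∃ r ∈ R, (r ∉ Vt ∨ r = u) ∧ Linked G Vt r y := by
      rcases hx with hx | ⟨hx, r, hr, hr', hl⟩
      · exact ⟨x, hx.1, hx.2, Or.inl hxy⟩
      · exact ⟨r, hr, hr', hl.trans_adj hx hxy⟩
    by_cases hyt : y ∈ Vt
    · exact Or.inr ⟨hyt, r, hr, hr', hl⟩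
    · refine Or.inl ⟨?_, Or.inl hyt⟩
      by_cases hry : r = y
      · exact hry ▸ hr
      · refine (hR r hr y ((hH _ _).2 ⟨by tauto, by tauto, hry, hl⟩)).resolve_right fun h => ?_
        exact hy (Finset.mem_filter.2 ⟨h, hyt⟩)
  obtain ⟨m⟩ := ‹Nonempty M›
  obtain ⟨E, h0, hbr, hbyz⟩ := exists_silent_execution G Vt f B huB m
  obtain ⟨t, ht⟩ := (h B hBt (hBcard.trans_le (min_le_left _ _)) huB hvB E).1 0 m h0
  replace ht := ht.resolve_right fun h => huv h.1.symm
  have hs := E.step t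
  rw [ht] at hs
  have hcard : (C' \ B).card ≤ f := by
    rw [Finset.card_sdiff_of_subset hBC]
    omega
  obtain ⟨l, hl, hlC⟩ := hs.2.1.exists_disjoint_stored hcard
  obtain ⟨x, hx, hxC⟩ := E.exists_mem_of_stored hu (fun p a t h => (hbr p a t h).1) hbyz
    (Or.inl ⟨huR, Or.inr rfl⟩) hC't hZ hvZ (Finset.disjoint_right.1 hC't hv) hl
  exact hlC x hx hxC

end Main

end DolevUT

theorem mainTheorem5 {V : Type*} [Fintype V] [DecidableEq V] {M : Type*} [Nonempty M]
    (G : SimpleGraph V) [DecidableRel G.Adj] (Vt : Finset V) (f : ℕ)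
    (u v : V) (hu : u ∈ Vt) (hv : v ∈ Vt) (huv : u ≠ v)
    (H : (⊤ : SimpleGraph V).Subgraph)
    (hH : H = DolevUT.insertTrusted G Vt
      (DolevUT.insertTrusted G Vt (DolevUT.untrustedGraph G Vt) u) v) :
    (DolevUT.CommunicateReliably M G Vt f u v ↔
      u ∈ H.neighborSet v ∨ ((2 * f + 1 : ℕ) : ℕ∞) ≤ DolevUT.vertexConnectivity H u v) ∧
    (DolevUT.ValidityBetween M G Vt f u v ↔
      u ∈ H.neighborSet v ∨ ((2 * f + 1 : ℕ) : ℕ∞) ≤ DolevUT.vertexConnectivity H u v) := by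

  have hadj : ∀ x y, H.Adj x y ↔ (x ∉ Vt ∨ x = u ∨ x = v) ∧ (y ∉ Vt ∨ y = u ∨ y = v) ∧ x ≠ y ∧
      DolevUT.Linked G Vt x y := fun x y => by
    rw [hH]
    exact DolevUT.insertTrusted_insertTrusted_adj hu hv huv
  have hlink : ∀ x y, H.Adj x y → DolevUT.Linked G Vt x y := fun x y h => ((hadj x y).1 h).2.2.2
  rw [DolevUT.le_vertexConnectivity, SimpleGraph.Subgraph.mem_neighborSet, H.adj_comm]
  have hsuff : H.Adj u v ∨ DolevUT.HasDisjointPaths H u v (2 * f + 1) →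
      DolevUT.CommunicateReliably M G Vt f u v := fun h B hBt hBf huB hvB E =>
    ⟨⟨E.validity_of_connectivity hlink hu hv huv h hBt hBf, E.noCreation hBt hBf huB,
        E.noDuplication huv⟩,
      E.validity_of_connectivity hlink hv hu huv.symm (h.imp (fun h => h.symm) fun h => h.symm)
        hBt hBf, E.noCreation hBt hBf hvB, E.noDuplication huv.symm⟩
  have hvalid : DolevUT.CommunicateReliably M G Vt f u v →
      DolevUT.ValidityBetween M G Vt f u v := fun h B hBt hBf huB hvB E =>
    ⟨(h B hBt hBf huB hvB E).1.1, (h B hBt hBf huB hvB E).2.1⟩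
  exact ⟨⟨fun h => (hvalid h).connectivity hu hv huv hadj, hsuff⟩,
    fun h => h.connectivity hu hv huv hadj, fun h => hvalid (hsuff h)⟩
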